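/- Fix integers $C\ge 1$ and $K\ge 0$ and a vector $\bm p=(p_1,\dots,p_C)\in\mathbb R^C$; write $\tilde{\bm p}=(p_1,\dots,p_{C-1})^T$. A batched multinomial model with batch sizes $n_1,\dots,n_K\in\mathbb N$ consists of random vectors $\bm\varepsilon_j=(\varepsilon_{1j},\dots,\varepsilon_{(C-1)j})^T$ in $\mathbb R^{C-1}$ and $\bm X_j=(X_{1j},\dots,X_{Cj})^T$ in $\mathbb N^C$, $1\le j\le K$, on a common probability space such that, with $\varepsilon_{Cj}:=-\sum_{c=1}^{C-1}\varepsilon_{cj}$: - $\bm\varepsilon_1,\dots,\bm\varepsilon_K$ are independent, $\mathbb E(\varepsilon_{cj})=0$ for $1\le c\le C-1$, and almost surely $(p_1+\varepsilon_{1j},\dots,p_C+\varepsilon_{Cj})$ is a probability vector; - $\bm X_1,\dots,\bm X_K$ are independent, and the conditional law of $\bm X_j$ given $\bm\varepsilon_j$ is $\mathrm{Multinomial}(n_j,p_1+\varepsilon_{1j},\dots,p_C+\varepsilon_{Cj})$. Let $N_j=\sum_{i=1}^j n_i$ and $Y_{cj}=\sum_{i=1}^j X_{ci}$. For real random variables $U,V$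 let $\mathrm{Cov}(U,V)$ denote the $2\times2$ variance-covariance matrix of $(U,V)$. Consider a sequence, indexed by $\nu\in\mathbb N$, of such models with the same $C$, $K$, $\bm p$ (batch sizes, perturbations, counts and probability space may depend on $\nu$; the index $\nu$ is suppressed). Then the following hold. (a) For every model of the sequence and every $j$, the $X_{cj}$ are square integrable, $\mathbb E(X_{cj})=n_jp_c$ for all $c$, and for all $c\ne c'$ in $\{1,\dots,C\}$ $$\mathrm{Cov}(X_{cj},X_{c'j})=n_j\begin{bmatrix}p_c(1-p_c)&-p_cp_{c'}\\-p_cp_{c'}&p_{c'}(1-p_{c'})\end{bmatrix}+n_j(n_j-1)\,\mathrm{Cov}(\varepsilon_{cj},\varepsilon_{c'j}).$$ (b) For every model of the sequence and every $j$, the $Y_{cj}$ are square integrable, $\mathbb E(Y_{cj})=N_jp_c$ for all $c$, and for all $c\neq c'$ in $\{1,\dots,C\}$ $$\mathrm{Cov}(Y_{cj},Y_{c'j})=N_j\begin{bmatrix}p_c(1-p_c)&-p_cp_{c'}\\-p_cp_{c'}&p_{c'}(1-p_{c'})\end{bmatrix}+\sum_{i=1}^jn_i(n_i-1)\,\mathrm{Cov}(\varepsilon_{ci},\varepsilon_{c'i}).$$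 (c) Let $1\le j\le K$ and let $\Xi_{\bm\varepsilon}$ be a positive definite real $(C-1)\times(C-1)$ matrix. Suppose that, as $\nu\to\infty$, $n_j\to\infty$ and the density of $\sqrt{n_j}\,\bm\varepsilon_j$ (which exists for all large $\nu$) converges uniformly on $\mathbb R^{C-1}$ to the density of $\mathcal N_{C-1}(\bm 0,\Xi_{\bm\varepsilon})$. Then $\hat{\bm p}_j=(X_{1j}/n_j,\dots,X_{(C-1)j}/n_j)^T$ satisfies $$\sqrt{n_j}\,(\hat{\bm p}_j-\tilde{\bm p})\ \longrightarrow\ \mathcal N_{C-1}(\bm 0,\Xi_p+\Xi_{\bm\varepsilon})\quad\text{in law},$$ where $\Xi_p$ is the $(C-1)\times(C-1)$ matrix with diagonal entries $p_c(1-p_c)$ and off-diagonal entries $-p_cp_{c'}$. -/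

import Mathlib

open MeasureTheory ProbabilityTheory Filter Topology

/-- The multinomial law with `n` trials and cell probabilities `q`, as a measure on count vectors:
a vector `k` with `∑ c, k c = n` has mass `n! / ∏ c, (k c)! * ∏ c, q c ^ k c`. -/
noncomputable def multinomialLaw {ι : Type*} [Fintype ι] [DecidableEq ι] (n : ℕ) (q : ι → ℝ) :
    Measure (ι → ℕ) :=
  ∑ k ∈ Finset.piAntidiag Finset.univ n,
    ENNReal.ofReal ((Nat.multinomial Finset.univ k : ℝ) * ∏ c, q c ^ k c) • Measure.dirac k

/-- Sanity check: the multinomial law is a probability measure on the simplex. -/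
theorem isProbabilityMeasure_multinomialLaw {ι : Type*} [Fintype ι] [DecidableEq ι] (n : ℕ)
    {q : ι → ℝ} (hq : q ∈ stdSimplex ℝ ι) : IsProbabilityMeasure (multinomialLaw n q) := by
  constructor
  have h0 : ∀ k ∈ Finset.piAntidiag Finset.univ n,
      0 ≤ (Nat.multinomial Finset.univ k : ℝ) * ∏ c, q c ^ k c := fun k _ =>
    mul_nonneg (Nat.cast_nonneg _) (Finset.prod_nonneg fun c _ => pow_nonneg (hq.1 c) _)
  simp only [multinomialLaw, Measure.coe_finsetSum, Finset.sum_apply, Measure.smul_apply,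
    measure_univ, smul_eq_mul, mul_one]
  rw [← ENNReal.ofReal_sum_of_nonneg h0, ← Finset.sum_pow_eq_sum_piAntidiag, hq.2]
  simp

/-- The full vector of perturbations: the first `d = C - 1` are the entries of `e`, and the last
one is minus their sum. -/
noncomputable def fullPerturbation {d : ℕ} (e : EuclideanSpace ℝ (Fin d)) : Fin (d + 1) → ℝ :=
  Fin.snoc (α := fun _ => ℝ) (fun c => e c) (-∑ c, e c)

/-- The batched multinomial model with `C = d + 1` categories, `K` batches, batch sizes `n j`,
constant preference vector `p`, random perturbations `ε j` and counts `X j`. -/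
structure IsBatchedMultinomialModel {Ω : Type*} [MeasurableSpace Ω] {d K : ℕ} (P : Measure Ω)
    [IsProbabilityMeasure P] (p : Fin (d + 1) → ℝ) (n : Fin K → ℕ)
    (ε : Fin K → Ω → EuclideanSpace ℝ (Fin d)) (X : Fin K → Ω → Fin (d + 1) → ℕ) : Prop where
  measurable_perturbation : ∀ j, Measurable (ε j)
  measurable_count : ∀ j, Measurable (X j)
  /-- The perturbations of different batches are independent. -/
  indep_perturbation : iIndepFun ε P
  /-- The count vectors of different batches are independent. -/
  indep_count : iIndepFun X P
  /-- The perturbed vector `p + ε j` is almost surely a vector of cell probabilities. -/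
  mem_simplex : ∀ j, ∀ᵐ ω ∂P, p + fullPerturbation (ε j ω) ∈ stdSimplex ℝ (Fin (d + 1))
  /-- The perturbations have mean zero. -/
  mean_zero : ∀ j (c : Fin d), ∫ ω, ε j ω c ∂P = 0
  /-- Given `ε j`, the counts of batch `j` are multinomial with cell probabilities `p + ε j`. -/
  condLaw : ∀ j, ∀ᵐ ω ∂P,
    condDistrib (X j) (ε j) P (ε j ω) = multinomialLaw (n j) (p + fullPerturbation (ε j ω))

/-- Cumulative number of trials up to and including batch `j`. -/
def cumTrials {K : ℕ} (n : Fin K → ℕ) (j : Fin K) : ℕ := ∑ i ∈ Finset.Iic j, n i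

/-- Cumulative counts up to and including batch `j`. -/
def cumCount {Ω : Type*} {d K : ℕ} (X : Fin K → Ω → Fin (d + 1) → ℕ) (j : Fin K) (ω : Ω)
    (c : Fin (d + 1)) : ℕ := ∑ i ∈ Finset.Iic j, X i ω c

/-- The variance-covariance matrix of a pair of real random variables. -/
noncomputable def pairCov {Ω : Type*} [MeasurableSpace Ω] (U V : Ω → ℝ) (P : Measure Ω) :
    Matrix (Fin 2) (Fin 2) ℝ :=
  !![covariance U U P, covariance U V P; covariance V U P, covariance V V P]

/-- The `2 × 2` multinomial covariance block of categories `c` and `c'`. -/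
def multinomialBlock {ι : Type*} (p : ι → ℝ) (c c' : ι) : Matrix (Fin 2) (Fin 2) ℝ :=
  !![p c * (1 - p c), -(p c * p c'); -(p c * p c'), p c' * (1 - p c')]

/-- The covariance matrix `Ξ_p` of the first `d` cells for one multinomial trial. -/
def multinomialCov {d : ℕ} (p : Fin (d + 1) → ℝ) : Matrix (Fin d) (Fin d) ℝ :=
  Matrix.of fun a b =>
    if a = b then p a.castSucc * (1 - p a.castSucc) else -(p a.castSucc * p b.castSucc)

/-- The density of the centred normal law with positive definite dispersion matrix `S`. -/
noncomputable def gaussianDensity {d : ℕ} (S : Matrix (Fin d) (Fin d) ℝ)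
    (x : EuclideanSpace ℝ (Fin d)) : ℝ :=
  (Real.sqrt ((2 * Real.pi) ^ d * S.det))⁻¹ *
    Real.exp (-(x.ofLp ⬝ᵥ (S⁻¹).mulVec x.ofLp) / 2)

/-- For all large `ν` the random vector `Z ν` has a density with respect to Lebesgue measure, and
these densities converge uniformly to `g` as `ν → ∞`. -/
def DensityTendstoUniformly {d : ℕ} {Ω : ℕ → Type*} [∀ ν, MeasurableSpace (Ω ν)]
    (P : ∀ ν, Measure (Ω ν)) (Z : ∀ ν, Ω ν → EuclideanSpace ℝ (Fin d))
    (g : EuclideanSpace ℝ (Fin d) → ℝ) : Prop :=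
  ∃ f : ℕ → EuclideanSpace ℝ (Fin d) → ℝ,
    (∀ ν, Measurable (f ν)) ∧ (∀ ν x, 0 ≤ f ν x) ∧
    (∀ᶠ ν in atTop, (P ν).map (Z ν) = volume.withDensity fun x => ENNReal.ofReal (f ν x)) ∧
    TendstoUniformly f g atTop

/-- The first `d` observed proportions `k c / n`. -/
noncomputable def proportions {d : ℕ} (n : ℕ) (k : Fin (d + 1) → ℕ) : EuclideanSpace ℝ (Fin d) :=
  WithLp.toLp 2 fun c => (k c.castSucc : ℝ) / n

/-- The first `d` entries of `p`. -/
noncomputable def firstCells {d : ℕ} (p : Fin (d + 1) → ℝ) : EuclideanSpace ℝ (Fin d) :=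
  WithLp.toLp 2 fun c => p c.castSucc

/-! Parts (a) and (b) are conditioning. Given the perturbation, the counts are multinomial with `q =
p + ε`, so their first and second moments are explicit polynomials in `q`. Integrating over `ε`,
terms linear in `ε` vanish and the quadratic ones produce `n (n - 1) Cov(ε)`. Independence of the
count vectors then makes covariances add over batches.

Part (c) compares characteristic functions. With `s = n^(-1/2)`, a linear form of the standardized
proportions is `∑ X_c s u_c`, where the coefficients `u` are centred under `p`. Conditionally on `ε`
its characteristic function is `a ^ n`, with `a` that of one trial. A second order expansion shows
that `a` differs from `b = exp(i s ⟪ε, t⟫ - s² V / 2)`, `V` being the quadratic form of `Ξ_p`, by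
`O(s³ + s² ∑ |ε_c|)`. Both lie in the unit disc, so the `n`-th powers differ by at most `n` times
that, which after integration is `O(s + E ∑ |ε_c|)`. Moreover `b ^ n = exp(i ⟪√n ε, t⟫) exp(-V /
2)`, the integrand for an independent sum of `√n ε` and a normal vector (`norm_charFun_sub_le`).

Scheffé's lemma turns convergence of densities into convergence of integrals of bounded functions
(`tendsto_integral_of_tendsto_density`). This gives both the limit of the characteristic function of
`√n ε` and `E ∑ |ε_c| → 0`. Lévy's continuity theorem concludes. -/

/-! ### Generating function and moments of the multinomial law. -/

section Multinomial

variable {ι : Type*} [Fintype ι] [DecidableEq ι]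

/-- Integrals against the multinomial law are finite sums over the lattice simplex. -/
theorem integral_multinomialLaw {F : Type*} [NormedAddCommGroup F] [NormedSpace ℝ F]
    [CompleteSpace F] (n : ℕ) {q : ι → ℝ} (hq : ∀ c, 0 ≤ q c) (f : (ι → ℕ) → F) :
    ∫ k, f k ∂multinomialLaw n q =
      ∑ k ∈ Finset.piAntidiag Finset.univ n,
        ((Nat.multinomial Finset.univ k : ℝ) * ∏ c, q c ^ k c) • f k := by
  rw [multinomialLaw, integral_finsetSum_measure]
  · refine Finset.sum_congr rfl fun k _ => ?_
    rw [integral_smul_measure, integral_dirac, ENNReal.toReal_ofReal]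
    exact mul_nonneg (Nat.cast_nonneg _) (Finset.prod_nonneg fun c _ => pow_nonneg (hq c) _)
  · exact fun k _ => (integrable_dirac (by simp)).smul_measure ENNReal.ofReal_ne_top

/-- The probability generating function of the multinomial law. -/
theorem integral_multinomialLaw_prod_pow {𝕜 : Type*} [RCLike 𝕜] (n : ℕ) {q : ι → ℝ}
    (hq : ∀ c, 0 ≤ q c) (z : ι → 𝕜) :
    ∫ k, ∏ c, z c ^ k c ∂multinomialLaw n q = (∑ c, (q c : 𝕜) * z c) ^ n := by
  rw [integral_multinomialLaw n hq, Finset.sum_pow_eq_sum_piAntidiag]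
  refine Finset.sum_congr rfl fun k _ => ?_
  rw [RCLike.real_smul_eq_coe_mul]
  push_cast
  simp_rw [mul_pow, Finset.prod_mul_distrib]
  ring

/-- First and second moments of a linear statistic of a multinomial vector. -/
theorem integral_multinomialLaw_linear_and_sq (n : ℕ) {q : ι → ℝ} (hq : q ∈ stdSimplex ℝ ι)
    (u : ι → ℝ) :
    ∫ k, ∑ c, u c * (k c : ℝ) ∂multinomialLaw n q = n * ∑ c, q c * u c ∧
    ∫ k, (∑ c, u c * (k c : ℝ)) ^ 2 ∂multinomialLaw n q =
      n * ((n : ℝ) - 1) * (∑ c, q c * u c) ^ 2 + n * ∑ c, q c * u c ^ 2 := by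
  rw [integral_multinomialLaw n hq.1, integral_multinomialLaw n hq.1]
  set w : (ι → ℕ) → ℝ := fun k => (Nat.multinomial Finset.univ k : ℝ) * ∏ c, q c ^ k c
  set S := Finset.piAntidiag (Finset.univ : Finset ι) n
  set ℓ : (ι → ℕ) → ℝ := fun k => ∑ c, u c * (k c : ℝ)
  -- Two expressions for the moment generating function of the linear statistic; differentiating
  -- both once and twice at `0` gives the moments.
  have hF : (fun s => ∑ k ∈ S, w k * Real.exp (s * ℓ k)) =
      fun s => (∑ c, q c * Real.exp (s * u c)) ^ n := by
    funext s
    have h := integral_multinomialLaw_prod_pow (𝕜 := ℝ) n hq.1 fun c => Real.exp (s * u c)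
    rw [integral_multinomialLaw n hq.1] at h
    refine Eq.trans (Finset.sum_congr rfl fun k _ => ?_) h
    simp only [w, ℓ, smul_eq_mul, ← Real.exp_nat_mul, ← Real.exp_sum, Finset.mul_sum]
    congr 3
    funext c
    ring
  have hG (m : ℕ) (s : ℝ) : HasDerivAt (fun s => ∑ c, q c * u c ^ m * Real.exp (s * u c))
      (∑ c, q c * u c ^ (m + 1) * Real.exp (s * u c)) s := by
    refine HasDerivAt.fun_sum fun c _ => ?_
    have := (((hasDerivAt_id s).mul_const (u c)).exp).const_mul (q c * u c ^ m)
    refine this.congr_deriv ?_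
    simp only [id]
    ring
  have hL (m : ℕ) (s : ℝ) : HasDerivAt (fun s => ∑ k ∈ S, w k * ℓ k ^ m * Real.exp (s * ℓ k))
      (∑ k ∈ S, w k * ℓ k ^ (m + 1) * Real.exp (s * ℓ k)) s := by
    refine HasDerivAt.fun_sum fun k _ => ?_
    have := (((hasDerivAt_id s).mul_const (ℓ k)).exp).const_mul (w k * ℓ k ^ m)
    refine this.congr_deriv ?_
    simp only [id]
    ring
  have hG0 := hG 0
  have hL0 := hL 0
  simp only [pow_zero, mul_one, zero_add, pow_one] at hG0 hL0
  have hG1 := hG 1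
  have hL1 := hL 1
  simp only [pow_one, Nat.reduceAdd] at hG1 hL1
  have h1 (s : ℝ) : ∑ k ∈ S, w k * ℓ k * Real.exp (s * ℓ k) =
      n * (∑ c, q c * Real.exp (s * u c)) ^ (n - 1) * ∑ c, q c * u c * Real.exp (s * u c) :=
    (hF ▸ hL0 s).unique ((hG0 s).pow n)
  have h2 := ((funext h1 : (fun s => _) = _) ▸ hL1 0).unique
    ((((hG0 0).pow (n - 1)).const_mul (n : ℝ)).mul (hG1 0))
  have h1 := h1 0
  simp only [zero_mul, Real.exp_zero, mul_one, hq.2, one_pow, Pi.pow_apply] at h1 h2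
  refine ⟨h1, h2.trans ?_⟩
  -- The differentiated power carries a truncated `n - 1`, so `n = 0` is treated apart; there both
  -- sides vanish.
  rcases n with - | n
  · simp
  · simp only [Nat.add_sub_cancel]
    push_cast
    ring

theorem integral_multinomialLaw_apply (n : ℕ) {q : ι → ℝ} (hq : q ∈ stdSimplex ℝ ι) (c : ι) :
    ∫ k, (k c : ℝ) ∂multinomialLaw n q = n * q c := by
  simpa [Pi.single_apply] using
    (integral_multinomialLaw_linear_and_sq n hq (Pi.single c 1)).1

theorem integral_multinomialLaw_mul (n : ℕ) {q : ι → ℝ} (hq : q ∈ stdSimplex ℝ ι) (c c' : ι) :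
    ∫ k, (k c : ℝ) * (k c' : ℝ) ∂multinomialLaw n q =
      n * ((n : ℝ) - 1) * (q c * q c') + if c = c' then n * q c else 0 := by
  have hp := (integral_multinomialLaw_linear_and_sq n hq (Pi.single c 1 + Pi.single c' 1)).2
  have hm := (integral_multinomialLaw_linear_and_sq n hq (Pi.single c 1 - Pi.single c' 1)).2
  rw [integral_multinomialLaw n hq.1] at hp hm ⊢
  -- Polarization: a product is a quarter of the difference of the squares of sum and difference,
  -- which reduces mixed moments to second moments of linear statistics.
  have h : ∀ k : ι → ℕ, (k c : ℝ) * (k c' : ℝ) =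
      (1 / 4) * ((∑ i, (Pi.single c 1 + Pi.single c' 1 : ι → ℝ) i * (k i : ℝ)) ^ 2 -
        (∑ i, (Pi.single c 1 - Pi.single c' 1 : ι → ℝ) i * (k i : ℝ)) ^ 2) := by
    intro k
    simp only [Pi.add_apply, Pi.sub_apply, add_mul, sub_mul, Finset.sum_add_distrib,
      Finset.sum_sub_distrib, Pi.single_apply, ite_mul, one_mul, zero_mul, Finset.sum_ite_eq',
      Finset.mem_univ, if_true]
    ring
  simp_rw [h, smul_eq_mul, mul_left_comm _ (1 / 4 : ℝ), ← Finset.mul_sum, mul_sub,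
    Finset.sum_sub_distrib]
  simp only [smul_eq_mul] at hp hm
  rw [hp, hm]
  simp only [Pi.add_apply, Pi.sub_apply, mul_add, mul_sub, Finset.sum_add_distrib,
      Finset.sum_sub_distrib, Pi.single_apply, mul_ite, mul_one, mul_zero, Finset.sum_ite_eq',
      Finset.mem_univ, if_true]
  have e : (∑ x, q x * ((if x = c then 1 else 0) + if x = c' then (1:ℝ) else 0) ^ 2) -
      (∑ x, q x * ((if x = c then 1 else 0) - if x = c' then (1:ℝ) else 0) ^ 2) =
      4 * if c = c' then q c else 0 := by
    rw [← Finset.sum_sub_distrib]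
    have : ∀ x, q x * ((if x = c then 1 else 0) + if x = c' then (1:ℝ) else 0) ^ 2 -
      q x * ((if x = c then 1 else 0) - if x = c' then (1:ℝ) else 0) ^ 2 =
      if x = c then 4 * (if c = c' then q c else 0) else 0 := by
      intro x
      split_ifs <;> simp_all; ring
    simp_rw [this]
    simp
  have e' : (if c = c' then (n : ℝ) * q c else 0) = n * if c = c' then q c else 0 := by
    split_ifs <;> simp
  rw [e']
  linear_combination (n / 4 : ℝ) * e

/-- The multinomial law is carried by the lattice simplex. -/
theorem ae_mem_piAntidiag_multinomialLaw (n : ℕ) (q : ι → ℝ) :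
    ∀ᵐ k ∂multinomialLaw n q, k ∈ Finset.piAntidiag Finset.univ n := by
  rw [ae_iff, multinomialLaw]
  simp only [Measure.coe_finsetSum, Finset.sum_apply, Measure.smul_apply]
  refine Finset.sum_eq_zero fun k hk => ?_
  rw [Measure.dirac_apply' _ (Set.to_countable _).measurableSet]
  simp only [Finset.mem_piAntidiag] at hk
  simp [hk]

end Multinomial

/-! ### Estimates for the characteristic function of one trial. -/

/-- Telescoping in the unit disc. It transfers the one-trial estimate to `n` trials at the cost of a
factor `n`. -/
theorem norm_pow_sub_pow_le_mul {R : Type*} [SeminormedCommRing R] [NormOneClass R] {a b : R}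
    (ha : ‖a‖ ≤ 1) (hb : ‖b‖ ≤ 1) (n : ℕ) : ‖a ^ n - b ^ n‖ ≤ n * ‖a - b‖ := by
  induction n with
  | zero => simp
  | succ n ih =>
    have h : a ^ (n + 1) - b ^ (n + 1) = a ^ n * (a - b) + (a ^ n - b ^ n) * b := by ring
    have ha' : ‖a ^ n‖ ≤ 1 := (norm_pow_le a n).trans (pow_le_one₀ (norm_nonneg _) ha)
    calc ‖a ^ (n + 1) - b ^ (n + 1)‖ ≤ ‖a ^ n‖ * ‖a - b‖ + ‖a ^ n - b ^ n‖ * ‖b‖ := by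
          rw [h]
          exact (norm_add_le _ _).trans (add_le_add (norm_mul_le _ _) (norm_mul_le _ _))
      _ ≤ 1 * ‖a - b‖ + (n * ‖a - b‖) * 1 := by gcongr
      _ = ((n + 1 : ℕ) : ℝ) * ‖a - b‖ := by push_cast; ring

theorem norm_cexp_mul_I_sub_taylor_le {x : ℝ} (hx : |x| ≤ 1) :
    ‖Complex.exp (x * Complex.I) - (1 + x * Complex.I - (x : ℂ) ^ 2 / 2)‖ ≤ |x| ^ 3 := by
  have h := Complex.exp_bound (x := x * Complex.I) (by simpa using hx) (n := 3) (by norm_num)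
  have e : ∑ m ∈ Finset.range 3, (x * Complex.I) ^ m / (m.factorial : ℂ) =
      1 + x * Complex.I - (x : ℂ) ^ 2 / 2 := by
    simp [Finset.sum_range_succ, mul_pow, Complex.I_sq, Nat.factorial]
    ring
  rw [e] at h
  refine h.trans ?_
  simp only [norm_mul, Complex.norm_real, Complex.norm_I, mul_one, Real.norm_eq_abs]
  have : (0 : ℝ) ≤ |x| ^ 3 := by positivity
  norm_num [Nat.factorial]
  linarith

section

variable {ι : Type*} [Fintype ι]

theorem sum_abs_sub_le_two {p q : ι → ℝ} (hp : p ∈ stdSimplex ℝ ι)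
    (hq : q ∈ stdSimplex ℝ ι) : ∑ c, |q c - p c| ≤ 2 := by
  calc ∑ c, |q c - p c| ≤ ∑ c, (q c + p c) := Finset.sum_le_sum fun c _ => by
        rw [abs_le]; constructor <;> linarith [hp.1 c, hq.1 c]
    _ = 2 := by rw [Finset.sum_add_distrib, hp.2, hq.2]; norm_num

/-- The characteristic function of one trial with cell probabilities `q` close to `p` is close to
the exponential of its second order expansion. -/
theorem norm_sum_mul_cexp_sub_cexp_le {p q x : ι → ℝ} {δ : ℝ} (hp : p ∈ stdSimplex ℝ ι)
    (hq : q ∈ stdSimplex ℝ ι) (hδ : δ ≤ 1 / 3) (hx : ∀ c, |x c| ≤ δ) (hpx : ∑ c, p c * x c = 0) :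
    ‖∑ c, (q c : ℂ) * Complex.exp (x c * Complex.I) -
        Complex.exp ((∑ c, q c * x c : ℝ) * Complex.I - (∑ c, p c * x c ^ 2 : ℝ) / 2)‖ ≤
      2 * δ ^ 3 + 5 * δ ^ 2 * ∑ c, |q c - p c| := by
  obtain ⟨c₀⟩ : Nonempty ι := by
    by_contra h
    rw [not_nonempty_iff] at h
    simpa using hp.2
  have hδ0 : 0 ≤ δ := (abs_nonneg _).trans (hx c₀)
  set e := ∑ c, |q c - p c| with he
  have he0 : 0 ≤ e := Finset.sum_nonneg fun _ _ => abs_nonneg _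
  have he2 : e ≤ 2 := sum_abs_sub_le_two hp hq
  have hx2 : ∀ c, x c ^ 2 ≤ δ ^ 2 := fun c => sq_le_sq' (abs_le.1 (hx c)).1 (abs_le.1 (hx c)).2
  set A := ∑ c, q c * x c
  set V := ∑ c, p c * x c ^ 2
  -- Centring under `p` lets `q` be replaced by `q - p`, so the linear term is small with `e`, not
  -- merely with `δ`.
  have hA : |A| ≤ δ * e := by
    have : A = ∑ c, (q c - p c) * x c := by
      simp only [sub_mul, Finset.sum_sub_distrib, hpx, sub_zero]; rfl
    rw [this, he, Finset.mul_sum]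
    refine (Finset.abs_sum_le_sum_abs _ _).trans (Finset.sum_le_sum fun c _ => ?_)
    rw [abs_mul, mul_comm]
    gcongr
    exact hx c
  have hV0 : 0 ≤ V := Finset.sum_nonneg fun c _ => mul_nonneg (hp.1 c) (sq_nonneg _)
  have hV : V ≤ δ ^ 2 := by
    calc V ≤ ∑ c, p c * δ ^ 2 := Finset.sum_le_sum fun c _ =>
          mul_le_mul_of_nonneg_left (hx2 c) (hp.1 c)
      _ = δ ^ 2 := by rw [← Finset.sum_mul, hp.2, one_mul]
  set w : ℂ := (A : ℂ) * Complex.I - (V : ℂ) / 2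
  have hw : ‖w‖ ≤ δ * e + δ ^ 2 / 2 := by
    refine (norm_sub_le _ _).trans ?_
    simp only [norm_mul, norm_div, Complex.norm_real, Complex.norm_I, mul_one, Real.norm_eq_abs,
      Complex.norm_ofNat, abs_of_nonneg hV0]
    linarith
  have hw1 : ‖w‖ ≤ 1 := hw.trans (by nlinarith)
  have h1 : ‖∑ c, (q c : ℂ) * (Complex.exp (x c * Complex.I) -
      (1 + x c * Complex.I - (x c : ℂ) ^ 2 / 2))‖ ≤ δ ^ 3 := by
    calc _ ≤ ∑ c, q c * δ ^ 3 := by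
          refine (norm_sum_le _ _).trans (Finset.sum_le_sum fun c _ => ?_)
          rw [norm_mul, Complex.norm_real, Real.norm_eq_abs, abs_of_nonneg (hq.1 c)]
          refine mul_le_mul_of_nonneg_left ?_ (hq.1 c)
          refine (norm_cexp_mul_I_sub_taylor_le ((hx c).trans (by linarith))).trans ?_
          exact pow_le_pow_left₀ (abs_nonneg _) (hx c) 3
      _ = δ ^ 3 := by rw [← Finset.sum_mul, hq.2, one_mul]
  have h2 : ‖((∑ c, (q c - p c) * x c ^ 2 : ℝ) : ℂ) / 2‖ ≤ δ ^ 2 * e / 2 := by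
    rw [norm_div, Complex.norm_real, Real.norm_eq_abs, Complex.norm_ofNat]
    gcongr
    rw [he, Finset.mul_sum]
    refine (Finset.abs_sum_le_sum_abs _ _).trans (Finset.sum_le_sum fun c _ => ?_)
    rw [abs_mul, mul_comm, abs_of_nonneg (sq_nonneg (x c))]
    exact mul_le_mul_of_nonneg_right (hx2 c) (abs_nonneg _)
  have h3 := Complex.norm_exp_sub_one_sub_id_le hw1
  have h4 : ‖w‖ ^ 2 ≤ (δ * e + δ ^ 2 / 2) ^ 2 := pow_le_pow_left₀ (norm_nonneg _) hw 2
  -- Three errors: the Taylor remainder of each exponential, the replacement of `q` by `p` in the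
  -- quadratic term, and the remainder of `exp w` beyond first order.
  have key : ∑ c, (q c : ℂ) * Complex.exp (x c * Complex.I) - Complex.exp w =
      ∑ c, (q c : ℂ) * (Complex.exp (x c * Complex.I) -
        (1 + x c * Complex.I - (x c : ℂ) ^ 2 / 2)) -
      ((∑ c, (q c - p c) * x c ^ 2 : ℝ) : ℂ) / 2 - (Complex.exp w - 1 - w) := by
    have hq1 : ∑ c, (q c : ℂ) = 1 := by exact_mod_cast hq.2
    simp only [w, A, V]
    push_cast
    simp only [mul_sub, mul_add, sub_mul, Finset.sum_sub_distrib, Finset.sum_add_distrib, mul_one,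
      hq1, ← mul_div_assoc, ← Finset.sum_div, ← mul_assoc, ← Finset.sum_mul]
    ring
  rw [key]
  have h5 := norm_sub_le (∑ c, (q c : ℂ) * (Complex.exp (x c * Complex.I) -
        (1 + x c * Complex.I - (x c : ℂ) ^ 2 / 2)) -
      ((∑ c, (q c - p c) * x c ^ 2 : ℝ) : ℂ) / 2) (Complex.exp w - 1 - w)
  have h6 := norm_sub_le (∑ c, (q c : ℂ) * (Complex.exp (x c * Complex.I) -
        (1 + x c * Complex.I - (x c : ℂ) ^ 2 / 2)))
      (((∑ c, (q c - p c) * x c ^ 2 : ℝ) : ℂ) / 2)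
  -- The square is expanded and each monomial absorbed using `e ≤ 2` and `δ ≤ 1 / 3`.
  have h7 : (δ * e + δ ^ 2 / 2) ^ 2 ≤ 4 * δ ^ 2 * e + δ ^ 3 := by
    have a1 : δ ^ 2 * (e * e) ≤ δ ^ 2 * (2 * e) := by gcongr
    have a2 : δ ^ 3 * e ≤ δ ^ 2 * (1 / 3) * e := by
      have : δ ^ 3 = δ ^ 2 * δ := by ring
      rw [this]; gcongr
    have a3 : δ ^ 4 ≤ δ ^ 3 * (1 / 3) := by
      have : δ ^ 4 = δ ^ 3 * δ := by ring
      rw [this]; gcongr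
    have a4 : 0 ≤ δ ^ 3 := by positivity
    have a5 : 0 ≤ δ ^ 2 * e := by positivity
    nlinarith
  have a5 : 0 ≤ δ ^ 2 * e := by positivity
  linarith

end

/-! ### Convergence of integrals from convergence of densities. -/

section Scheffe

variable {α : Type*} [MeasurableSpace α] {μ : Measure α}

/-- **Scheffé's lemma**: pointwise convergence of densities with the same total mass implies
convergence in `L¹`. -/
theorem tendsto_integral_abs_sub_of_tendsto_of_integral_eq {f : ℕ → α → ℝ} {g : α → ℝ}
    (hf : ∀ᶠ ν in atTop, Integrable (f ν) μ) (hf0 : ∀ ν x, 0 ≤ f ν x) (hg : Integrable g μ)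
    (hg0 : ∀ x, 0 ≤ g x) (hfg : ∀ᶠ ν in atTop, ∫ x, f ν x ∂μ = ∫ x, g x ∂μ)
    (hlim : ∀ x, Tendsto (fun ν => f ν x) atTop (𝓝 (g x))) :
    Tendsto (fun ν => ∫ x, |f ν x - g x| ∂μ) atTop (𝓝 0) := by
  -- The negative part of `f ν - g` is dominated by `g`, so dominated convergence applies to it.
  -- Equal total masses then control the positive part.
  have h : Tendsto (fun ν => ∫ x, max (g x - f ν x) 0 ∂μ) atTop (𝓝 (∫ _, (0 : ℝ) ∂μ)) := by
    refine tendsto_integral_filter_of_dominated_convergence g ?_ ?_ hg ?_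
    · filter_upwards [hf] with ν h
      exact (hg.sub h).pos_part.aestronglyMeasurable
    · refine Eventually.of_forall fun ν => ae_of_all _ fun x => ?_
      rw [Real.norm_eq_abs, abs_of_nonneg (le_max_right _ _)]
      exact max_le (by linarith [hf0 ν x]) (hg0 x)
    · refine ae_of_all _ fun x => ?_
      have := ((hlim x).const_sub (g x)).max (tendsto_const_nhds (x := (0 : ℝ)))
      simpa using this
  rw [integral_zero] at h
  have h2 := h.const_mul 2
  rw [mul_zero] at h2
  refine h2.congr' ?_
  filter_upwards [hf, hfg] with ν h h'
  have e : ∀ x, |f ν x - g x| = (f ν x - g x) + 2 * max (g x - f ν x) 0 := by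
    intro x
    rcases le_total (f ν x) (g x) with hx | hx
    · rw [abs_of_nonpos (by linarith), max_eq_left (by linarith)]; ring
    · rw [abs_of_nonneg (by linarith), max_eq_right (by linarith)]; ring
  simp_rw [e]
  have i1 : Integrable (fun x => f ν x - g x) μ := h.sub hg
  have i2 : Integrable (fun x => max (g x - f ν x) 0) μ := (hg.sub h).pos_part
  rw [integral_add i1 (i2.const_mul 2), integral_sub h hg, h', sub_self, zero_add,
    integral_const_mul]

/-- If the densities of probability measures converge pointwise to a probability density, then
the integrals of uniformly bounded, pointwise convergent functions converge. -/
theorem tendsto_integral_of_tendsto_density {F : Type*} [NormedAddCommGroup F] [NormedSpace ℝ F]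
    [CompleteSpace F]
    {f : ℕ → α → ℝ} {g : α → ℝ} {m : ℕ → Measure α} {m₀ : Measure α}
    [∀ ν, IsProbabilityMeasure (m ν)] [IsProbabilityMeasure m₀]
    (hfm : ∀ ν, Measurable (f ν)) (hf0 : ∀ ν x, 0 ≤ f ν x) (hgm : Measurable g)
    (hg0 : ∀ x, 0 ≤ g x)
    (hm : ∀ᶠ ν in atTop, m ν = μ.withDensity fun x => ENNReal.ofReal (f ν x))
    (hm₀ : m₀ = μ.withDensity fun x => ENNReal.ofReal (g x))
    (hlim : ∀ x, Tendsto (fun ν => f ν x) atTop (𝓝 (g x)))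
    {h : ℕ → α → F} {h₀ : α → F} {M : ℝ} (hh : ∀ ν, StronglyMeasurable (h ν))
    (hM : ∀ ν x, ‖h ν x‖ ≤ M) (hhlim : ∀ x, Tendsto (fun ν => h ν x) atTop (𝓝 (h₀ x))) :
    Tendsto (fun ν => ∫ x, h ν x ∂(m ν)) atTop (𝓝 (∫ x, h₀ x ∂m₀)) := by
  have density (k : α → ℝ) (hkm : Measurable k) (hk0 : ∀ x, 0 ≤ k x) (m' : Measure α)
      [IsProbabilityMeasure m'] (hm' : m' = μ.withDensity fun x => ENNReal.ofReal (k x)) :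
      Integrable k μ ∧ ∫ x, k x ∂μ = 1 ∧ ∀ φ : α → F, ∫ x, φ x ∂m' = ∫ x, k x • φ x ∂μ := by
    have h1 : ∫⁻ x, ENNReal.ofReal (k x) ∂μ = 1 := by
      have := measure_univ (μ := m')
      rwa [hm', withDensity_apply _ MeasurableSet.univ, Measure.restrict_univ] at this
    refine ⟨⟨hkm.aestronglyMeasurable, ?_⟩, ?_, fun φ => ?_⟩
    · rw [hasFiniteIntegral_iff_ofReal (ae_of_all _ hk0), h1]
      exact ENNReal.one_lt_top
    · rw [integral_eq_lintegral_of_nonneg_ae (ae_of_all _ hk0) hkm.aestronglyMeasurable, h1]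
      rfl
    · rw [hm', integral_withDensity_eq_integral_toReal_smul hkm.ennreal_ofReal (by simp)]
      simp only [ENNReal.toReal_ofReal (hk0 _)]
  obtain ⟨hgi, hg1, hgφ⟩ := density g hgm hg0 m₀ hm₀
  have hL1 := tendsto_integral_abs_sub_of_tendsto_of_integral_eq
    (by filter_upwards [hm] with ν h using (density (f ν) (hfm ν) (hf0 ν) (m ν) h).1) hf0 hgi hg0
    (by filter_upwards [hm] with ν h using
      (density (f ν) (hfm ν) (hf0 ν) (m ν) h).2.1.trans hg1.symm) hlim
  -- Split `f • h = g • h + (f - g) • h`: dominated convergence handles the first term, Scheffé with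
  -- the uniform bound `M` the second.
  have hA : Tendsto (fun ν => ∫ x, g x • h ν x ∂μ) atTop (𝓝 (∫ x, g x • h₀ x ∂μ)) := by
    refine tendsto_integral_filter_of_dominated_convergence (fun x => g x * M) ?_ ?_
      (hgi.mul_const M) ?_
    · exact Eventually.of_forall fun ν =>
        hgm.aestronglyMeasurable.smul (hh ν).aestronglyMeasurable
    · refine Eventually.of_forall fun ν => ae_of_all _ fun x => ?_
      rw [norm_smul, Real.norm_eq_abs, abs_of_nonneg (hg0 x)]
      exact mul_le_mul_of_nonneg_left (hM ν x) (hg0 x)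
    · exact ae_of_all _ fun x => (hhlim x).const_smul _
  have hB : Tendsto (fun ν => ∫ x, (f ν x - g x) • h ν x ∂μ) atTop (𝓝 0) := by
    have hL := hL1.mul_const M
    rw [zero_mul] at hL
    refine squeeze_zero_norm' ?_ hL
    filter_upwards [hm] with ν hν
    have hfi := (density (f ν) (hfm ν) (hf0 ν) (m ν) hν).1
    rw [← integral_mul_const]
    refine norm_integral_le_of_norm_le ((hfi.sub hgi).abs.mul_const M) (ae_of_all _ fun x => ?_)
    rw [norm_smul, Real.norm_eq_abs]
    exact mul_le_mul_of_nonneg_left (hM ν x) (abs_nonneg _)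
  have hAB := hA.add hB
  rw [add_zero, ← hgφ] at hAB
  refine hAB.congr' ?_
  filter_upwards [hm] with ν hν
  obtain ⟨hfi, -, hfφ⟩ := density (f ν) (hfm ν) (hf0 ν) (m ν) hν
  have bdd (k : α → ℝ) (hk : Integrable k μ) : Integrable (fun x => k x • h ν x) μ :=
    hk.smul_bdd M (hh ν).aestronglyMeasurable (ae_of_all _ (hM ν))
  have hsub : Integrable (fun x => f ν x - g x) μ := hfi.sub hgi
  rw [hfφ, ← integral_add (bdd g hgi) (bdd _ hsub)]
  refine integral_congr_ae (ae_of_all _ fun x => ?_)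
  simp only [← add_smul, add_sub_cancel]

end Scheffe

/-! ### The explicit Gaussian density and its Fourier transform. -/

section GaussianDensity

variable {d : ℕ}

open scoped RealInnerProductSpace Matrix MatrixOrder

theorem continuous_gaussianDensity (S : Matrix (Fin d) (Fin d) ℝ) :
    Continuous (gaussianDensity S) := by
  unfold gaussianDensity
  have h : Continuous fun x : EuclideanSpace ℝ (Fin d) => x.ofLp ⬝ᵥ S⁻¹ *ᵥ x.ofLp := by
    simp only [dotProduct, Matrix.mulVec]
    fun_prop
  fun_prop

theorem gaussianDensity_nonneg (S : Matrix (Fin d) (Fin d) ℝ) (x : EuclideanSpace ℝ (Fin d)) :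
    0 ≤ gaussianDensity S x := by
  unfold gaussianDensity
  positivity

/-- The Fourier transform of the centred Gaussian density. -/
theorem integral_gaussianDensity_mul_cexp {S : Matrix (Fin d) (Fin d) ℝ} (hS : S.PosDef)
    (t : EuclideanSpace ℝ (Fin d)) :
    ∫ x, (gaussianDensity S x : ℂ) * Complex.exp (⟪x, t⟫ * Complex.I) =
      Complex.exp (-((t.ofLp ⬝ᵥ S *ᵥ t.ofLp : ℝ) : ℂ) / 2) := by
  -- The substitution `x = M v` with the symmetric square root of `S` reduces to the standard
  -- Gaussian integral; its Jacobian `|det M| = √(det S)` cancels the normalizing constant.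
  set M := CFC.sqrt S
  have hMM : M * M = S := CFC.sqrt_mul_sqrt_self S hS.posSemidef.nonneg
  have hMT : Mᵀ = M := by
    have := (CFC.sqrt_nonneg S).isSelfAdjoint
    rwa [IsSelfAdjoint, Matrix.star_eq_conjTranspose, Matrix.conjTranspose_eq_transpose_of_trivial]
      at this
  have hdetS : 0 < S.det := hS.det_pos
  have hdet : M.det * M.det = S.det := by rw [← Matrix.det_mul, hMM]
  have hdetM : M.det ≠ 0 := fun h => by rw [h] at hdet; simp at hdet; linarith
  have hMSM : M * S⁻¹ * M = 1 := by
    have hu : IsUnit M.det := isUnit_iff_ne_zero.2 hdetM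
    rw [← hMM, Matrix.mul_inv_rev, ← mul_assoc, Matrix.mul_nonsing_inv _ hu, one_mul,
      Matrix.nonsing_inv_mul _ hu]
  set L : EuclideanSpace ℝ (Fin d) →ₗ[ℝ] EuclideanSpace ℝ (Fin d) := Matrix.toLpLin 2 2 M
  have hLdet : LinearMap.det L = M.det := LinearMap.det_toLpLin 2 M
  have hLofLp (v : EuclideanSpace ℝ (Fin d)) : (L v).ofLp = M *ᵥ v.ofLp := rfl
  have hinner (v w : EuclideanSpace ℝ (Fin d)) : ⟪v, w⟫ = v.ofLp ⬝ᵥ w.ofLp := by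
    rw [EuclideanSpace.inner_eq_star_dotProduct, star_trivial, dotProduct_comm]
  have hmap := Measure.map_linearMap_addHaar_eq_smul_addHaar
    (volume : Measure (EuclideanSpace ℝ (Fin d))) (f := L) (by rwa [hLdet])
  have hLc : Continuous L := LinearMap.continuous_of_finiteDimensional L
  set F : EuclideanSpace ℝ (Fin d) → ℂ :=
    fun x => (gaussianDensity S x : ℂ) * Complex.exp (⟪x, t⟫ * Complex.I)
  have hFc : Continuous F := by
    have := continuous_gaussianDensity S
    fun_prop
  have hcv : ∫ v, F (L v) = |M.det|⁻¹ * ∫ x, F x := by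
    rw [← integral_map hLc.aemeasurable hFc.aestronglyMeasurable, hmap, integral_smul_measure,
      ENNReal.toReal_ofReal (abs_nonneg _), hLdet, abs_inv, Complex.real_smul]
  set κ : ℝ := (Real.sqrt ((2 * Real.pi) ^ d * S.det))⁻¹
  have hFL (v : EuclideanSpace ℝ (Fin d)) :
      F (L v) = κ * Complex.exp (-(1 / 2 : ℂ) * ‖v‖ ^ 2 + Complex.I * ⟪L t, v⟫) := by
    have h1 : (L v).ofLp ⬝ᵥ S⁻¹ *ᵥ (L v).ofLp = ‖v‖ ^ 2 := by
      rw [hLofLp, ← real_inner_self_eq_norm_sq, hinner]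
      nth_rewrite 1 [← hMT]
      rw [Matrix.mulVec_transpose, ← Matrix.dotProduct_mulVec, Matrix.mulVec_mulVec,
        Matrix.mulVec_mulVec, hMSM, Matrix.one_mulVec]
    have h2 : ⟪L v, t⟫ = ⟪L t, v⟫ := by
      rw [hinner, hinner, hLofLp, hLofLp]
      nth_rewrite 1 [← hMT]
      rw [Matrix.mulVec_transpose, ← Matrix.dotProduct_mulVec, dotProduct_comm]
    have h3 : gaussianDensity S (L v) = κ * Real.exp (-‖v‖ ^ 2 / 2) := by
      rw [gaussianDensity, h1]
    simp only [F]
    rw [h2, h3, Complex.ofReal_mul, mul_assoc, Complex.ofReal_exp, ← Complex.exp_add]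
    congr 2
    push_cast
    ring
  have hLt : ‖L t‖ ^ 2 = t.ofLp ⬝ᵥ S *ᵥ t.ofLp := by
    rw [← real_inner_self_eq_norm_sq, hinner, hLofLp]
    nth_rewrite 1 [← hMT]
    rw [Matrix.mulVec_transpose, ← Matrix.dotProduct_mulVec, Matrix.mulVec_mulVec, hMM]
  have hgauss := GaussianFourier.integral_cexp_neg_mul_sq_norm_add (b := (1 / 2 : ℂ))
    (by norm_num) Complex.I (L t)
  simp_rw [hFL, integral_const_mul] at hcv
  rw [hgauss, finrank_euclideanSpace_fin] at hcv
  have hpow : ((Real.pi : ℂ) / (1 / 2)) ^ ((d : ℂ) / 2) = (Real.sqrt ((2 * Real.pi) ^ d) : ℝ) := by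
    rw [Real.sqrt_eq_rpow, ← Real.rpow_natCast, ← Real.rpow_mul (by positivity),
      Complex.ofReal_cpow (by positivity)]
    push_cast
    congr 1 <;> ring
  have hκ : κ * Real.sqrt ((2 * Real.pi) ^ d) * |M.det| = 1 := by
    have : Real.sqrt S.det = |M.det| := by rw [← hdet, Real.sqrt_mul_self_eq_abs]
    simp only [κ]
    rw [Real.sqrt_mul (by positivity), this]
    have h1 : Real.sqrt ((2 * Real.pi) ^ d) ≠ 0 := by positivity
    have h2 : |M.det| ≠ 0 := abs_ne_zero.2 hdetM
    field_simp
  have habs : ((|M.det| : ℝ) : ℂ) ≠ 0 := by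
    exact_mod_cast abs_ne_zero.2 hdetM
  have hκ' : (κ : ℂ) * (Real.sqrt ((2 * Real.pi) ^ d) : ℝ) * (|M.det| : ℝ) = 1 := by
    exact_mod_cast hκ
  have e1 : Complex.I ^ 2 * ((‖L t‖ : ℝ) : ℂ) ^ 2 / (4 * (1 / 2)) =
      -((t.ofLp ⬝ᵥ S *ᵥ t.ofLp : ℝ) : ℂ) / 2 := by
    rw [← hLt, Complex.I_sq]
    push_cast
    ring
  rw [hpow, e1] at hcv
  calc ∫ x, F x = (|M.det| : ℝ) * (((|M.det|⁻¹ : ℝ) : ℂ) * ∫ x, F x) := by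
        rw [← mul_assoc, Complex.ofReal_inv, mul_inv_cancel₀ habs, one_mul]
    _ = _ := by
        rw [← hcv]
        linear_combination
          Complex.exp (-((t.ofLp ⬝ᵥ S *ᵥ t.ofLp : ℝ) : ℂ) / 2) * hκ'

/-- Both measures have the same characteristic function; the Fourier transform at `t = 0` supplies
total mass one. -/
theorem withDensity_gaussianDensity {S : Matrix (Fin d) (Fin d) ℝ} (hS : S.PosDef) :
    volume.withDensity (fun x => ENNReal.ofReal (gaussianDensity S x)) =
      multivariateGaussian 0 S := by
  have h0 : ∫ x, gaussianDensity S x = 1 := by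
    have := integral_gaussianDensity_mul_cexp hS 0
    simp only [inner_zero_right, Complex.ofReal_zero, zero_mul, Complex.exp_zero, mul_one,
      integral_complex_ofReal] at this
    simpa using this
  have hi : Integrable (gaussianDensity S) := by
    by_contra h
    rw [integral_undef h] at h0
    exact zero_ne_one h0
  have : IsProbabilityMeasure
      (volume.withDensity fun x => ENNReal.ofReal (gaussianDensity S x)) := by
    constructor
    rw [withDensity_apply _ MeasurableSet.univ, Measure.restrict_univ,
      ← ofReal_integral_eq_lintegral_ofReal hi (ae_of_all _ (gaussianDensity_nonneg S)), h0,
      ENNReal.ofReal_one]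
  refine Measure.ext_of_charFun (funext fun t => ?_)
  rw [charFun_multivariateGaussian hS.posSemidef, charFun_apply,
    integral_withDensity_eq_integral_toReal_smul
      (continuous_gaussianDensity S).measurable.ennreal_ofReal (by simp)]
  simp only [ENNReal.toReal_ofReal (gaussianDensity_nonneg S _), Complex.real_smul]
  rw [integral_gaussianDensity_mul_cexp hS]
  congr 1
  simp [neg_div]

end GaussianDensity

/-! ### The perturbation vector completed by its last entry. -/

section Perturbation

variable {d : ℕ}

@[simp] theorem fullPerturbation_castSucc (e : EuclideanSpace ℝ (Fin d)) (c : Fin d) :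
    fullPerturbation e c.castSucc = e c := by
  simp [fullPerturbation]

@[simp] theorem fullPerturbation_last (e : EuclideanSpace ℝ (Fin d)) :
    fullPerturbation e (Fin.last d) = -∑ c, e c := by
  simp [fullPerturbation]

theorem sum_fullPerturbation (e : EuclideanSpace ℝ (Fin d)) : ∑ c, fullPerturbation e c = 0 := by
  simp [Fin.sum_univ_castSucc]

theorem sum_abs_fullPerturbation_le (e : EuclideanSpace ℝ (Fin d)) :
    ∑ c, |fullPerturbation e c| ≤ 2 * ∑ c, |e c| := by
  rw [Fin.sum_univ_castSucc]
  simp only [fullPerturbation_castSucc, fullPerturbation_last, abs_neg]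
  linarith [Finset.abs_sum_le_sum_abs (fun c => e c) Finset.univ]

theorem continuous_fullPerturbation :
    Continuous (fullPerturbation : EuclideanSpace ℝ (Fin d) → Fin (d + 1) → ℝ) := by
  refine continuous_pi fun c => ?_
  induction c using Fin.lastCases with
  | last => simp only [fullPerturbation_last]; fun_prop
  | cast c => simp only [fullPerturbation_castSucc]; fun_prop

end Perturbation

/-! ### Moments of batch counts and cumulative counts. -/

namespace IsBatchedMultinomialModel

variable {Ω : Type*} [MeasurableSpace Ω] {d K : ℕ} {P : Measure Ω} [IsProbabilityMeasure P]
  {p : Fin (d + 1) → ℝ} {n : Fin K → ℕ} {ε : Fin K → Ω → EuclideanSpace ℝ (Fin d)}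
  {X : Fin K → Ω → Fin (d + 1) → ℕ}

/-- The law of the counts is the mixture of the conditional laws, almost all of which charge only
the lattice simplex. -/
theorem ae_count_mem (h : IsBatchedMultinomialModel P p n ε X) (j : Fin K) :
    ∀ᵐ ω ∂P, X j ω ∈ Finset.piAntidiag Finset.univ (n j) := by
  have hc := condDistrib_comp_map (μ := P) (h.measurable_perturbation j).aemeasurable
    (h.measurable_count j).aemeasurable
  refine ae_of_ae_map (h.measurable_count j).aemeasurable ?_
  rw [← hc]
  refine Measure.ae_comp_of_ae_ae (Set.to_countable _).measurableSet ?_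
  refine (ae_map_iff (h.measurable_perturbation j).aemeasurable ?_).2 ?_
  · exact (Kernel.measurable_coe (condDistrib (X j) (ε j) P)
      (Set.to_countable {k | k ∉ Finset.piAntidiag Finset.univ (n j)}).measurableSet)
      (measurableSet_singleton 0)
  · filter_upwards [h.condLaw j] with ω hω
    rw [hω]
    exact ae_mem_piAntidiag_multinomialLaw _ _

/-- Almost surely the counts take finitely many values, so any function of them is bounded. -/
theorem memLp_count (h : IsBatchedMultinomialModel P p n ε X) (j : Fin K) {F : Type*}
    [NormedAddCommGroup F] (f : (Fin (d + 1) → ℕ) → F) (r : ENNReal) :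
    MemLp (fun ω => f (X j ω)) r P := by
  refine MemLp.of_bound (C := ∑ k ∈ Finset.piAntidiag Finset.univ (n j), ‖f k‖) ?_ ?_
  · exact ((StronglyMeasurable.of_discrete (f := f)).comp_measurable
      (h.measurable_count j)).aestronglyMeasurable
  · filter_upwards [h.ae_count_mem j] with ω hω
    exact Finset.single_le_sum (f := fun k => ‖f k‖) (fun _ _ => norm_nonneg _) hω

/-- Integrals of functions of the counts, computed by conditioning on the perturbations. -/
theorem integral_count (h : IsBatchedMultinomialModel P p n ε X) (j : Fin K) {F : Type*}
    [NormedAddCommGroup F] [NormedSpace ℝ F] [CompleteSpace F] (f : (Fin (d + 1) → ℕ) → F) :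
    ∫ ω, f (X j ω) ∂P =
      ∫ ω, ∫ k, f k ∂multinomialLaw (n j) (p + fullPerturbation (ε j ω)) ∂P := by
  have hce := condExp_ae_eq_integral_condDistrib (μ := P) (h.measurable_perturbation j)
    (h.measurable_count j).aemeasurable (StronglyMeasurable.of_discrete (f := f))
    (memLp_one_iff_integrable.1 (h.memLp_count j f 1))
  rw [← integral_condExp (h.measurable_perturbation j).comap_le, integral_congr_ae hce]
  refine integral_congr_ae ?_
  filter_upwards [h.condLaw j] with ω hω
  rw [hω]

theorem memLp_fullPerturbation (h : IsBatchedMultinomialModel P p n ε X) (j : Fin K)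
    (c : Fin (d + 1)) (r : ENNReal) : MemLp (fun ω => fullPerturbation (ε j ω) c) r P := by
  refine MemLp.of_bound (C := 1 + |p c|) ?_ ?_
  · exact ((measurable_pi_apply c).comp (continuous_fullPerturbation.measurable.comp
      (h.measurable_perturbation j))).aestronglyMeasurable
  · filter_upwards [h.mem_simplex j] with ω hω
    have h0 := hω.1 c
    have h1 := Finset.single_le_sum (fun i _ => hω.1 i) (Finset.mem_univ c)
    rw [hω.2] at h1
    simp only [Pi.add_apply] at h0 h1
    rw [Real.norm_eq_abs, abs_le]
    constructor <;> linarith [neg_abs_le (p c), le_abs_self (p c)]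

theorem integrable_fullPerturbation (h : IsBatchedMultinomialModel P p n ε X) (j : Fin K)
    (c : Fin (d + 1)) : Integrable (fun ω => fullPerturbation (ε j ω) c) P :=
  memLp_one_iff_integrable.1 (h.memLp_fullPerturbation j c 1)

theorem integral_fullPerturbation (h : IsBatchedMultinomialModel P p n ε X) (j : Fin K)
    (c : Fin (d + 1)) : ∫ ω, fullPerturbation (ε j ω) c ∂P = 0 := by
  induction c using Fin.lastCases with
  | last =>
    simp only [fullPerturbation_last]
    rw [integral_neg, integral_finsetSum]
    · simp [h.mean_zero j]
    · intro c _
      simpa using h.integrable_fullPerturbation j c.castSucc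
  | cast c => simpa using h.mean_zero j c

/-- The mean of the random cell probabilities is a vector of cell probabilities. -/
theorem mem_stdSimplex (h : IsBatchedMultinomialModel P p n ε X) (j : Fin K) :
    p ∈ stdSimplex ℝ (Fin (d + 1)) := by
  constructor
  · intro c
    have h0 : 0 ≤ ∫ ω, (p c + fullPerturbation (ε j ω) c) ∂P := by
      refine integral_nonneg_of_ae ?_
      filter_upwards [h.mem_simplex j] with ω hω using hω.1 c
    rwa [integral_add (integrable_const _) (h.integrable_fullPerturbation j c),
      h.integral_fullPerturbation, integral_const, probReal_univ, one_smul, add_zero] at h0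
  · obtain ⟨ω, hω⟩ := (h.mem_simplex j).exists
    simpa [Finset.sum_add_distrib, sum_fullPerturbation] using hω.2

theorem integral_count_apply (h : IsBatchedMultinomialModel P p n ε X) (j : Fin K)
    (c : Fin (d + 1)) : ∫ ω, (X j ω c : ℝ) ∂P = n j * p c := by
  rw [h.integral_count j fun k => (k c : ℝ)]
  have : ∀ᵐ ω ∂P, ∫ k, (k c : ℝ) ∂multinomialLaw (n j) (p + fullPerturbation (ε j ω)) =
      n j * (p c + fullPerturbation (ε j ω) c) := by
    filter_upwards [h.mem_simplex j] with ω hω using integral_multinomialLaw_apply _ hω c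
  rw [integral_congr_ae this, integral_const_mul,
    integral_add (integrable_const _) (h.integrable_fullPerturbation j c),
    h.integral_fullPerturbation, integral_const, probReal_univ, one_smul, add_zero]

theorem covariance_count (h : IsBatchedMultinomialModel P p n ε X) (j : Fin K)
    (c c' : Fin (d + 1)) :
    covariance (fun ω => (X j ω c : ℝ)) (fun ω => (X j ω c' : ℝ)) P =
      n j * ((if c = c' then p c else 0) - p c * p c') + n j * ((n j : ℝ) - 1) *
        covariance (fun ω => fullPerturbation (ε j ω) c)
          (fun ω => fullPerturbation (ε j ω) c') P := by
  rw [covariance_eq_sub (h.memLp_count j (fun k => (k c : ℝ)) 2)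
    (h.memLp_count j (fun k => (k c' : ℝ)) 2),
    covariance_eq_sub (h.memLp_fullPerturbation j c 2) (h.memLp_fullPerturbation j c' 2)]
  simp only [Pi.mul_apply]
  rw [h.integral_count_apply, h.integral_count_apply, h.integral_fullPerturbation,
    h.integral_count j fun k => (k c : ℝ) * (k c' : ℝ)]
  -- The conditional mixed moment, sorted by degree in the perturbation: only the constant and the
  -- quadratic parts survive integration.
  have e : ∀ᵐ ω ∂P, ∫ k, (k c : ℝ) * (k c' : ℝ)
      ∂multinomialLaw (n j) (p + fullPerturbation (ε j ω)) =
      (n j * ((n j : ℝ) - 1) * (p c * p c') + n j * (if c = c' then p c else 0)) +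
      ((n j * ((n j : ℝ) - 1) * p c' + n j * (if c = c' then 1 else 0)) *
          fullPerturbation (ε j ω) c +
        n j * ((n j : ℝ) - 1) * p c * fullPerturbation (ε j ω) c' +
        n j * ((n j : ℝ) - 1) * (fullPerturbation (ε j ω) c * fullPerturbation (ε j ω) c')) := by
    filter_upwards [h.mem_simplex j] with ω hω
    rw [integral_multinomialLaw_mul _ hω]
    simp only [Pi.add_apply]
    split_ifs <;> ring
  have i1 := (h.integrable_fullPerturbation j c).const_mul
    (n j * ((n j : ℝ) - 1) * p c' + n j * (if c = c' then 1 else 0))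
  have i2 := (h.integrable_fullPerturbation j c').const_mul (n j * ((n j : ℝ) - 1) * p c)
  have i3 : Integrable (fun ω => n j * ((n j : ℝ) - 1) *
      (fullPerturbation (ε j ω) c * fullPerturbation (ε j ω) c')) P :=
    ((h.memLp_fullPerturbation j c 2).integrable_mul
      (h.memLp_fullPerturbation j c' 2)).const_mul _
  have i12 := i1.add i2
  have i123 := i12.add i3
  simp only [Pi.add_def] at i12 i123
  rw [integral_congr_ae e, integral_add (integrable_const _) i123, integral_add i12 i3,
    integral_add i1 i2]
  simp only [integral_const_mul, h.integral_fullPerturbation, integral_const, probReal_univ,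
    one_smul]
  ring

theorem pairCov_count (h : IsBatchedMultinomialModel P p n ε X) (j : Fin K)
    {c c' : Fin (d + 1)} (hc : c ≠ c') :
    pairCov (fun ω => (X j ω c : ℝ)) (fun ω => (X j ω c' : ℝ)) P =
      (n j : ℝ) • multinomialBlock p c c' +
        ((n j : ℝ) * ((n j : ℝ) - 1)) •
          pairCov (fun ω => fullPerturbation (ε j ω) c)
            (fun ω => fullPerturbation (ε j ω) c') P := by
  ext a b
  fin_cases a <;> fin_cases b <;>
    simp [pairCov, multinomialBlock, h.covariance_count, hc, hc.symm, -mul_eq_mul_left_iff] <;>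
    ring

theorem memLp_cumCount (h : IsBatchedMultinomialModel P p n ε X) (j : Fin K)
    (c : Fin (d + 1)) : MemLp (fun ω => (cumCount X j ω c : ℝ)) 2 P := by
  simp only [cumCount, Nat.cast_sum]
  exact memLp_finsetSum _ fun i _ => h.memLp_count i (fun k => (k c : ℝ)) 2

theorem integral_cumCount (h : IsBatchedMultinomialModel P p n ε X) (j : Fin K)
    (c : Fin (d + 1)) : ∫ ω, (cumCount X j ω c : ℝ) ∂P = cumTrials n j * p c := by
  simp only [cumCount, cumTrials, Nat.cast_sum]
  rw [integral_finsetSum _ fun i _ => memLp_one_iff_integrable.1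
    (h.memLp_count i (fun k => (k c : ℝ)) 1), Finset.sum_mul]
  exact Finset.sum_congr rfl fun i _ => h.integral_count_apply i c

theorem covariance_cumCount (h : IsBatchedMultinomialModel P p n ε X) (j : Fin K)
    (c c' : Fin (d + 1)) :
    covariance (fun ω => (cumCount X j ω c : ℝ)) (fun ω => (cumCount X j ω c' : ℝ)) P =
      ∑ i ∈ Finset.Iic j,
        covariance (fun ω => (X i ω c : ℝ)) (fun ω => (X i ω c' : ℝ)) P := by
  simp only [cumCount, Nat.cast_sum]
  rw [covariance_fun_sum_fun_sum' (fun i _ => h.memLp_count i (fun k => (k c : ℝ)) 2)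
    (fun i _ => h.memLp_count i (fun k => (k c' : ℝ)) 2)]
  refine Finset.sum_congr rfl fun i hi => ?_
  -- In the double sum over batches, terms from two different batches vanish by independence.
  refine Finset.sum_eq_single_of_mem i hi fun i' _ hne => ?_
  refine IndepFun.covariance_eq_zero ?_ (h.memLp_count i (fun k => (k c : ℝ)) 2)
    (h.memLp_count i' (fun k => (k c' : ℝ)) 2)
  exact (h.indep_count.indepFun hne.symm).comp (φ := fun k => (k c : ℝ))
    (ψ := fun k => (k c' : ℝ)) .of_discrete .of_discrete

theorem pairCov_cumCount (h : IsBatchedMultinomialModel P p n ε X) (j : Fin K)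
    {c c' : Fin (d + 1)} (hc : c ≠ c') :
    pairCov (fun ω => (cumCount X j ω c : ℝ)) (fun ω => (cumCount X j ω c' : ℝ)) P =
      (cumTrials n j : ℝ) • multinomialBlock p c c' +
        ∑ i ∈ Finset.Iic j, ((n i : ℝ) * ((n i : ℝ) - 1)) •
          pairCov (fun ω => fullPerturbation (ε i ω) c)
            (fun ω => fullPerturbation (ε i ω) c') P := by
  have e : pairCov (fun ω => (cumCount X j ω c : ℝ)) (fun ω => (cumCount X j ω c' : ℝ)) P =
      ∑ i ∈ Finset.Iic j, pairCov (fun ω => (X i ω c : ℝ)) (fun ω => (X i ω c' : ℝ)) P := by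
    ext a b
    rw [Matrix.sum_apply]
    fin_cases a <;> fin_cases b <;> simp [pairCov, h.covariance_cumCount]
  rw [e, Finset.sum_congr rfl fun i _ => h.pairCov_count i hc, Finset.sum_add_distrib, cumTrials,
    Nat.cast_sum, Finset.sum_smul]

end IsBatchedMultinomialModel

/-! ### Centred coefficients and the quadratic form of `Ξ_p`. -/

section MultinomialCov

open scoped RealInnerProductSpace

variable {d : ℕ}

/-- The coefficients `t c` of a linear form on the first `d` cells, extended by `0` to the last
cell and centred with respect to the cell probabilities `p`. -/
noncomputable def centredCoeff (p : Fin (d + 1) → ℝ) (t : EuclideanSpace ℝ (Fin d)) :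
    Fin (d + 1) → ℝ :=
  fun c => Fin.snoc (α := fun _ => ℝ) (fun a => t a) 0 c - ∑ a : Fin d, p a.castSucc * t a

/-- The centring constant enters only through the total weight: `1` for `p`, `0` for a perturbation,
`n` for the counts. -/
theorem sum_mul_centredCoeff (p : Fin (d + 1) → ℝ) (t : EuclideanSpace ℝ (Fin d))
    (w : Fin (d + 1) → ℝ) :
    ∑ c, w c * centredCoeff p t c =
      ∑ a : Fin d, w a.castSucc * t a - (∑ c, w c) * ∑ a : Fin d, p a.castSucc * t a := by
  simp only [centredCoeff, mul_sub, Finset.sum_sub_distrib, ← Finset.sum_mul]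
  rw [Fin.sum_univ_castSucc]
  simp

theorem sum_mul_centredCoeff_self {p : Fin (d + 1) → ℝ} (hp : ∑ c, p c = 1)
    (t : EuclideanSpace ℝ (Fin d)) : ∑ c, p c * centredCoeff p t c = 0 := by
  rw [sum_mul_centredCoeff, hp, one_mul, sub_self]

theorem sum_fullPerturbation_mul_centredCoeff (p : Fin (d + 1) → ℝ)
    (e t : EuclideanSpace ℝ (Fin d)) :
    ∑ c, fullPerturbation e c * centredCoeff p t c = ⟪e, t⟫ := by
  rw [sum_mul_centredCoeff, sum_fullPerturbation, zero_mul, sub_zero, PiLp.inner_apply]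
  simp [mul_comm]

/-- The quadratic form of `multinomialCov p` is the variance of the linear form under one trial. -/
theorem dotProduct_multinomialCov_mulVec {p : Fin (d + 1) → ℝ} (hp : ∑ c, p c = 1)
    (t : EuclideanSpace ℝ (Fin d)) :
    t.ofLp ⬝ᵥ (multinomialCov p).mulVec t.ofLp = ∑ c, p c * centredCoeff p t c ^ 2 := by
  set m := ∑ a : Fin d, p a.castSucc * t a with hm
  have h1 : ∑ c, p c * centredCoeff p t c ^ 2 = ∑ a : Fin d, p a.castSucc * t a ^ 2 - m ^ 2 := by
    have e : ∀ c, p c * centredCoeff p t c ^ 2 =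
        p c * Fin.snoc (α := fun _ => ℝ) (fun a => t a) 0 c ^ 2 -
          2 * m * (p c * centredCoeff p t c) - m ^ 2 * p c := by
      intro c
      simp only [centredCoeff, ← hm]
      ring
    simp_rw [e]
    rw [Finset.sum_sub_distrib, Finset.sum_sub_distrib, ← Finset.mul_sum, ← Finset.mul_sum, hp,
      sum_mul_centredCoeff_self hp, Fin.sum_univ_castSucc]
    simp
  have h2 : multinomialCov p = Matrix.diagonal (fun a : Fin d => p a.castSucc) -
      Matrix.vecMulVec (fun a : Fin d => p a.castSucc) (fun a : Fin d => p a.castSucc) := by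
    ext a b
    rcases eq_or_ne a b with rfl | hab
    · simp [multinomialCov, Matrix.vecMulVec_apply]; ring
    · simp [multinomialCov, Matrix.vecMulVec_apply, hab]
  rw [h1, h2, Matrix.sub_mulVec, dotProduct_sub, Matrix.vecMulVec_mulVec]
  congr 1
  · simp only [dotProduct, Matrix.mulVec_diagonal]
    exact Finset.sum_congr rfl fun a _ => by ring
  · simp only [dotProduct, Pi.smul_apply, MulOpposite.smul_eq_mul_unop, MulOpposite.unop_op]
    rw [← hm, sq]
    conv_rhs => rw [hm]
    rw [Finset.sum_mul]
    exact Finset.sum_congr rfl fun a _ => by ring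

theorem posSemidef_multinomialCov {p : Fin (d + 1) → ℝ} (hp : p ∈ stdSimplex ℝ (Fin (d + 1))) :
    (multinomialCov p).PosSemidef := by
  refine .of_dotProduct_mulVec_nonneg ?_ fun x => ?_
  · ext a b
    simp only [multinomialCov, Matrix.conjTranspose_apply, Matrix.of_apply, star_trivial]
    rcases eq_or_ne a b with rfl | hab
    · rfl
    · rw [if_neg hab, if_neg hab.symm, mul_comm]
  · rw [star_trivial]
    have := dotProduct_multinomialCov_mulVec hp.2 (WithLp.toLp 2 x)
    simp only at this
    rw [this]
    exact Finset.sum_nonneg fun c _ => mul_nonneg (hp.1 c) (sq_nonneg _)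

/-- A standardized linear form of the observed proportions in terms of the counts. -/
theorem inner_sqrt_smul_proportions_sub (p : Fin (d + 1) → ℝ) (t : EuclideanSpace ℝ (Fin d))
    {n : ℕ} {k : Fin (d + 1) → ℕ} (hk : ∑ c, k c = n) :
    ⟪Real.sqrt n • (proportions n k - firstCells p), t⟫ =
      ∑ c, (k c : ℝ) * ((Real.sqrt n)⁻¹ * centredCoeff p t c) := by
  have hk' : ∑ c, (k c : ℝ) = n := by exact_mod_cast hk
  simp_rw [mul_left_comm _ (Real.sqrt n)⁻¹, ← Finset.mul_sum]
  rw [sum_mul_centredCoeff, hk', real_inner_smul_left, PiLp.inner_apply]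
  have e : ∑ a : Fin d, inner ℝ ((proportions n k - firstCells p) a) (t a) =
      (∑ a : Fin d, (k a.castSucc : ℝ) * t a) / n - ∑ a : Fin d, p a.castSucc * t a := by
    rw [Finset.sum_div, ← Finset.sum_sub_distrib]
    refine Finset.sum_congr rfl fun a _ => ?_
    simp [proportions, firstCells]
    ring
  rw [e]
  -- With division by zero equal to zero, both square root identities also hold at `n = 0`.
  linear_combination (∑ a : Fin d, (k a.castSucc : ℝ) * t a) * Real.sqrt_div_self (x := (n : ℝ)) +
    (∑ a : Fin d, p a.castSucc * t a) * Real.div_sqrt (x := (n : ℝ))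

end MultinomialCov

/-! ### Comparison of characteristic functions for one batch. -/

section BatchCharFun

open scoped RealInnerProductSpace

variable {Ω : Type*} [MeasurableSpace Ω] {d K : ℕ} {P : Measure Ω} [IsProbabilityMeasure P]
  {p : Fin (d + 1) → ℝ} {n : Fin K → ℕ} {ε : Fin K → Ω → EuclideanSpace ℝ (Fin d)}
  {X : Fin K → Ω → Fin (d + 1) → ℕ}

/-- The characteristic function of the standardized proportions is close to that of the sum of the
standardized perturbation and an independent normal vector. -/
theorem IsBatchedMultinomialModel.norm_charFun_sub_le (h : IsBatchedMultinomialModel P p n ε X)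
    (j : Fin K) (hn : n j ≠ 0) (t : EuclideanSpace ℝ (Fin d)) {U : ℝ}
    (hU : ∀ c, |centredCoeff p t c| ≤ U) (hUn : (Real.sqrt (n j))⁻¹ * U ≤ 1 / 3) :
    ‖charFun (P.map fun ω => Real.sqrt (n j) • (proportions (n j) (X j ω) - firstCells p)) t -
        charFun (P.map fun ω => Real.sqrt (n j) • ε j ω) t *
          Complex.exp (-((t.ofLp ⬝ᵥ (multinomialCov p).mulVec t.ofLp : ℝ) : ℂ) / 2)‖ ≤
      2 * U ^ 3 * (Real.sqrt (n j))⁻¹ +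
        5 * U ^ 2 * ∫ ω, ∑ c, |fullPerturbation (ε j ω) c| ∂P := by
  have hp := h.mem_stdSimplex j
  set s := (Real.sqrt (n j))⁻¹ with hs
  set u := centredCoeff p t
  set V := t.ofLp ⬝ᵥ (multinomialCov p).mulVec t.ofLp with hV
  have hs0 : 0 ≤ s := by positivity
  have hns : (n j : ℝ) * s ^ 2 = 1 := by
    rw [hs, inv_pow, Real.sq_sqrt (Nat.cast_nonneg _), mul_inv_cancel₀ (by exact_mod_cast hn)]
  have hεm := h.measurable_perturbation j
  have hZm : Measurable fun ω => Real.sqrt (n j) • ε j ω :=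
    hεm.const_smul (Real.sqrt (n j))
  have hWm : Measurable fun ω =>
      Real.sqrt (n j) • (proportions (n j) (X j ω) - firstCells p) :=
    (Measurable.of_discrete (f := fun k : Fin (d + 1) → ℕ =>
      Real.sqrt (n j) • (proportions (n j) k - firstCells p))).comp (h.measurable_count j)
  have hcm : Continuous fun x : EuclideanSpace ℝ (Fin d) => Complex.exp (⟪x, t⟫ * Complex.I) := by
    fun_prop
  -- Conditionally on the perturbation, `a` is the characteristic function of one trial and `b` its
  -- Gaussian-type approximation.
  set a : Ω → ℂ := fun ω =>
    ∑ c, (((p + fullPerturbation (ε j ω)) c : ℝ) : ℂ) * Complex.exp ((s * u c : ℝ) * Complex.I)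
  set b : Ω → ℂ := fun ω =>
    Complex.exp ((∑ c, (p + fullPerturbation (ε j ω)) c * (s * u c) : ℝ) * Complex.I -
      (∑ c, p c * (s * u c) ^ 2 : ℝ) / 2)
  have hW : charFun (P.map fun ω =>
      Real.sqrt (n j) • (proportions (n j) (X j ω) - firstCells p)) t = ∫ ω, a ω ^ n j ∂P := by
    rw [charFun_apply, integral_map hWm.aemeasurable hcm.aestronglyMeasurable]
    have e1 : ∀ᵐ ω ∂P, Complex.exp
        (⟪Real.sqrt (n j) • (proportions (n j) (X j ω) - firstCells p), t⟫ * Complex.I) =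
        ∏ c, Complex.exp ((s * u c : ℝ) * Complex.I) ^ X j ω c := by
      filter_upwards [h.ae_count_mem j] with ω hω
      rw [inner_sqrt_smul_proportions_sub p t (Finset.mem_piAntidiag.1 hω).1]
      simp_rw [← Complex.exp_nat_mul, ← Complex.exp_sum]
      congr 1
      change ((∑ c, (X j ω c : ℝ) * (s * u c) : ℝ) : ℂ) * Complex.I = _
      push_cast
      rw [Finset.sum_mul]
      exact Finset.sum_congr rfl fun c _ => by ring
    rw [integral_congr_ae e1,
      h.integral_count j fun k => ∏ c, Complex.exp ((s * u c : ℝ) * Complex.I) ^ k c]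
    refine integral_congr_ae ?_
    filter_upwards [h.mem_simplex j] with ω hω
    exact integral_multinomialLaw_prod_pow (n j) hω.1 _
  have hb : ∀ ω, b ω ^ n j =
      Complex.exp (⟪Real.sqrt (n j) • ε j ω, t⟫ * Complex.I) * Complex.exp (-(V : ℂ) / 2) := by
    intro ω
    have e1 : ∑ c, (p + fullPerturbation (ε j ω)) c * (s * u c) = s * ⟪ε j ω, t⟫ := by
      simp_rw [mul_left_comm _ s, ← Finset.mul_sum, Pi.add_apply, add_mul,
        Finset.sum_add_distrib]
      rw [sum_mul_centredCoeff_self hp.2, sum_fullPerturbation_mul_centredCoeff, zero_add]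
    have e2 : ∑ c, p c * (s * u c) ^ 2 = s ^ 2 * V := by
      rw [hV, dotProduct_multinomialCov_mulVec hp.2, Finset.mul_sum]
      exact Finset.sum_congr rfl fun c _ => by ring
    have e3 : (n j : ℝ) * s = Real.sqrt (n j) := Real.div_sqrt
    have e3' : (n j : ℂ) * s = (Real.sqrt (n j) : ℝ) := by exact_mod_cast e3
    have e4 : (n j : ℂ) * (s : ℂ) ^ 2 = 1 := by exact_mod_cast hns
    simp only [b]
    rw [e1, e2, ← Complex.exp_nat_mul, ← Complex.exp_add, real_inner_smul_left]
    congr 1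
    push_cast
    linear_combination (⟪ε j ω, t⟫ : ℂ) * Complex.I * e3' - (V : ℂ) / 2 * e4
  have hZ : charFun (P.map fun ω => Real.sqrt (n j) • ε j ω) t * Complex.exp (-(V : ℂ) / 2) =
      ∫ ω, b ω ^ n j ∂P := by
    rw [charFun_apply, integral_map hZm.aemeasurable hcm.aestronglyMeasurable]
    simp_rw [hb]
    rw [integral_mul_const]
  have ha1 : ∀ᵐ ω ∂P, ‖a ω‖ ≤ 1 := by
    filter_upwards [h.mem_simplex j] with ω hω
    refine (norm_sum_le _ _).trans (le_of_eq ?_)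
    simp_rw [norm_mul, Complex.norm_exp_ofReal_mul_I, mul_one, Complex.norm_real, Real.norm_eq_abs]
    rw [← hω.2]
    exact Finset.sum_congr rfl fun c _ => abs_of_nonneg (hω.1 c)
  have hb1 : ∀ ω, ‖b ω‖ ≤ 1 := by
    intro ω
    have : 0 ≤ ∑ c, p c * (s * u c) ^ 2 :=
      Finset.sum_nonneg fun c _ => mul_nonneg (hp.1 c) (sq_nonneg _)
    simp only [b]
    rw [Complex.norm_exp, Real.exp_le_one_iff, Complex.sub_re, Complex.re_ofReal_mul, Complex.I_re,
      Complex.div_ofNat_re, Complex.ofReal_re]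
    linarith
  have hfm : Measurable fun ω => fullPerturbation (ε j ω) :=
    continuous_fullPerturbation.measurable.comp hεm
  have ham : Measurable a := by
    refine Finset.measurable_fun_sum _ fun c _ => ?_
    refine Measurable.mul_const (Complex.measurable_ofReal.comp ?_) _
    exact (measurable_pi_apply c).comp (measurable_const.add hfm)
  have hbm : Measurable b := by
    refine Complex.measurable_exp.comp (Measurable.sub_const (Measurable.mul_const
      (Complex.measurable_ofReal.comp ?_) _) _)
    refine Finset.measurable_fun_sum _ fun c _ => Measurable.mul_const ?_ _
    exact (measurable_pi_apply c).comp (measurable_const.add hfm)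
  have hai : Integrable (fun ω => a ω ^ n j) P := by
    refine Integrable.of_bound (ham.pow_const _).aestronglyMeasurable 1 ?_
    filter_upwards [ha1] with ω hω
    rw [norm_pow]
    exact pow_le_one₀ (norm_nonneg _) hω
  have hbi : Integrable (fun ω => b ω ^ n j) P := by
    refine Integrable.of_bound (hbm.pow_const _).aestronglyMeasurable 1 (ae_of_all _ fun ω => ?_)
    rw [norm_pow]
    exact pow_le_one₀ (norm_nonneg _) (hb1 ω)
  have hei : Integrable (fun ω => ∑ c, |fullPerturbation (ε j ω) c|) P :=
    integrable_finsetSum _ fun c _ => (h.integrable_fullPerturbation j c).abs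
  rw [hW, hZ, ← integral_sub hai hbi]
  have hR : 2 * U ^ 3 * s + 5 * U ^ 2 * ∫ ω, ∑ c, |fullPerturbation (ε j ω) c| ∂P =
      ∫ ω, (2 * U ^ 3 * s + 5 * U ^ 2 * ∑ c, |fullPerturbation (ε j ω) c|) ∂P := by
    rw [integral_add (integrable_const _) (hei.const_mul _), integral_const, probReal_univ,
      one_smul, integral_const_mul]
  rw [hR]
  refine norm_integral_le_of_norm_le ((integrable_const _).add (hei.const_mul _)) ?_
  filter_upwards [h.mem_simplex j, ha1] with ω hω ha
  refine (norm_pow_sub_pow_le_mul ha (hb1 ω) (n j)).trans ?_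
  have hx : ∀ c, |s * u c| ≤ s * U := fun c => by
    rw [abs_mul, abs_of_nonneg hs0]
    exact mul_le_mul_of_nonneg_left (hU c) hs0
  have hpx : ∑ c, p c * (s * u c) = 0 := by
    simp_rw [mul_left_comm _ s, ← Finset.mul_sum]
    rw [sum_mul_centredCoeff_self hp.2, mul_zero]
  -- Taken with `δ = s * U`; multiplying by `n j` and using `n s² = 1` leaves exactly the claimed
  -- bound.
  have key := norm_sum_mul_cexp_sub_cexp_le hp hω hUn hx hpx
  refine (mul_le_mul_of_nonneg_left key (Nat.cast_nonneg _)).trans (le_of_eq ?_)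
  simp only [Pi.add_apply, add_sub_cancel_left]
  linear_combination
    (2 * U ^ 3 * s + 5 * U ^ 2 * ∑ c, |fullPerturbation (ε j ω) c|) * hns

end BatchCharFun

/-! ### Passage to the limit. -/

section BatchLimit

open scoped RealInnerProductSpace

variable {d K : ℕ} {p : Fin (d + 1) → ℝ}
    {Ω : ℕ → Type*} [∀ ν, MeasurableSpace (Ω ν)]
    {P : ∀ ν, Measure (Ω ν)} [∀ ν, IsProbabilityMeasure (P ν)]

theorem DensityTendstoUniformly.tendsto_integral {F : Type*} [NormedAddCommGroup F]
    [NormedSpace ℝ F] [CompleteSpace F] {Z : ∀ ν, Ω ν → EuclideanSpace ℝ (Fin d)}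
    (hZ : ∀ ν, Measurable (Z ν)) {S : Matrix (Fin d) (Fin d) ℝ} (hS : S.PosDef)
    (hd : DensityTendstoUniformly P Z (gaussianDensity S))
    {h : ℕ → EuclideanSpace ℝ (Fin d) → F} {h₀ : EuclideanSpace ℝ (Fin d) → F} {M : ℝ}
    (hh : ∀ ν, StronglyMeasurable (h ν)) (hM : ∀ ν x, ‖h ν x‖ ≤ M)
    (hhlim : ∀ x, Tendsto (fun ν => h ν x) atTop (𝓝 (h₀ x))) :
    Tendsto (fun ν => ∫ ω, h ν (Z ν ω) ∂(P ν)) atTop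
      (𝓝 (∫ x, h₀ x ∂multivariateGaussian 0 S)) := by
  obtain ⟨f, hfm, hf0, hf, hlim⟩ := hd
  have (ν : ℕ) : IsProbabilityMeasure ((P ν).map (Z ν)) :=
    Measure.isProbabilityMeasure_map (hZ ν).aemeasurable
  have := tendsto_integral_of_tendsto_density (m := fun ν => (P ν).map (Z ν)) hfm hf0
    (continuous_gaussianDensity S).measurable (gaussianDensity_nonneg S) hf
    (withDensity_gaussianDensity hS).symm (fun x => hlim.tendsto_at x) hh hM hhlim
  refine this.congr fun ν => ?_
  rw [integral_map (hZ ν).aemeasurable (hh ν).aestronglyMeasurable]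

variable {n : ℕ → Fin K → ℕ} {ε : ∀ ν, Fin K → Ω ν → EuclideanSpace ℝ (Fin d)}
    {X : ∀ ν, Fin K → Ω ν → Fin (d + 1) → ℕ}

/-- The perturbation is `n^(-1/2)` times a vector converging in law, hence tends to `0` in
probability; it is bounded, so its mean absolute size tends to `0` too. -/
theorem tendsto_integral_sum_abs_fullPerturbation
    (hmodel : ∀ ν, IsBatchedMultinomialModel (P ν) p (n ν) (ε ν) (X ν)) (j : Fin K)
    {S : Matrix (Fin d) (Fin d) ℝ} (hS : S.PosDef)
    (hs : Tendsto (fun ν => (Real.sqrt (n ν j))⁻¹) atTop (𝓝 0))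
    (hn : ∀ᶠ ν in atTop, n ν j ≠ 0)
    (hd : DensityTendstoUniformly P (fun ν ω => Real.sqrt (n ν j) • ε ν j ω)
      (gaussianDensity S)) :
    Tendsto (fun ν => ∫ ω, ∑ c, |fullPerturbation (ε ν j ω) c| ∂(P ν)) atTop (𝓝 0) := by
  -- Truncation at `2` provides the uniform bound and loses nothing, since two probability vectors
  -- are at `ℓ¹` distance at most `2`.
  have key := hd.tendsto_integral (fun ν => ((hmodel ν).measurable_perturbation j).const_smul
    (Real.sqrt (n ν j))) hS (M := 2)
    (h := fun ν z => min 2 ((Real.sqrt (n ν j))⁻¹ * (2 * ∑ c, |z c|))) (h₀ := fun _ => (0 : ℝ))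
    (fun ν => (by fun_prop : Continuous _).stronglyMeasurable)
    (fun ν z => by
      rw [Real.norm_eq_abs, abs_of_nonneg (by positivity)]
      exact min_le_left _ _)
    (fun z => by
      have := (tendsto_const_nhds (x := (2 : ℝ))).min (hs.mul_const (2 * ∑ c, |z c|))
      simpa using this)
  rw [integral_zero] at key
  refine squeeze_zero' (Eventually.of_forall fun ν =>
    integral_nonneg fun ω => Finset.sum_nonneg fun c _ => abs_nonneg _) ?_ key
  filter_upwards [hn] with ν hν
  have hε := (hmodel ν).measurable_perturbation j
  refine integral_mono_ae (integrable_finsetSum _ fun c _ =>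
    ((hmodel ν).integrable_fullPerturbation j c).abs) ?_ ?_
  · refine Integrable.of_bound (C := 2) ?_ (ae_of_all _ fun ω => ?_)
    · refine Measurable.aestronglyMeasurable ?_
      exact (by fun_prop : Continuous fun z : EuclideanSpace ℝ (Fin d) =>
        min 2 ((Real.sqrt (n ν j))⁻¹ * (2 * ∑ c, |z c|))).measurable.comp
        (hε.const_smul (Real.sqrt (n ν j)))
    · rw [Real.norm_eq_abs, abs_of_nonneg (by positivity)]
      exact min_le_left _ _
  · filter_upwards [(hmodel ν).mem_simplex j] with ω hω
    refine le_min ?_ ?_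
    · simpa using sum_abs_sub_le_two ((hmodel ν).mem_stdSimplex j) hω
    · refine (sum_abs_fullPerturbation_le _).trans (le_of_eq ?_)
      have h0 : 0 ≤ Real.sqrt (n ν j) := Real.sqrt_nonneg _
      have h1 : Real.sqrt (n ν j) ≠ 0 := by positivity
      simp only [Pi.smul_apply, PiLp.smul_apply, smul_eq_mul, abs_mul, abs_of_nonneg h0, ← Finset.mul_sum]
      field_simp

theorem tendstoInDistribution_proportions
    (hmodel : ∀ ν, IsBatchedMultinomialModel (P ν) p (n ν) (ε ν) (X ν)) (j : Fin K)
    {S : Matrix (Fin d) (Fin d) ℝ} (hS : S.PosDef)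
    (hn : Tendsto (fun ν => n ν j) atTop atTop)
    (hd : DensityTendstoUniformly P (fun ν ω => Real.sqrt (n ν j) • ε ν j ω)
      (gaussianDensity S)) :
    TendstoInDistribution
      (fun ν ω => Real.sqrt (n ν j) • (proportions (n ν j) (X ν j ω) - firstCells p)) atTop
      (id : EuclideanSpace ℝ (Fin d) → EuclideanSpace ℝ (Fin d)) P
      (multivariateGaussian 0 (multinomialCov p + S)) where
  forall_aemeasurable ν := ((Measurable.of_discrete (f := fun k : Fin (d + 1) → ℕ =>
      Real.sqrt (n ν j) • (proportions (n ν j) k - firstCells p))).comp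
        ((hmodel ν).measurable_count j)).aemeasurable
  aemeasurable_limit := aemeasurable_id
  tendsto := by
    refine ProbabilityMeasure.tendsto_iff_tendsto_charFun.2 fun t => ?_
    simp only [ProbabilityMeasure.coe_mk, Measure.map_id]
    have hp := (hmodel 0).mem_stdSimplex j
    set V := t.ofLp ⬝ᵥ (multinomialCov p).mulVec t.ofLp
    have hs : Tendsto (fun ν => (Real.sqrt (n ν j))⁻¹) atTop (𝓝 0) :=
      tendsto_inv_atTop_zero.comp (Real.tendsto_sqrt_atTop.comp
        (tendsto_natCast_atTop_atTop.comp hn))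
    have hn0 : ∀ᶠ ν in atTop, n ν j ≠ 0 := hn.eventually_ne_atTop 0
    have hcm : Continuous fun x : EuclideanSpace ℝ (Fin d) =>
        Complex.exp (⟪x, t⟫ * Complex.I) := by fun_prop
    have hZm (ν : ℕ) : Measurable fun ω => Real.sqrt (n ν j) • ε ν j ω :=
      ((hmodel ν).measurable_perturbation j).const_smul (Real.sqrt (n ν j))
    have hZ : Tendsto (fun ν => charFun ((P ν).map fun ω => Real.sqrt (n ν j) • ε ν j ω) t) atTop
        (𝓝 (charFun (multivariateGaussian 0 S) t)) := by
      have := hd.tendsto_integral hZm hS (M := 1)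
        (h := fun _ x => Complex.exp (⟪x, t⟫ * Complex.I))
        (fun _ => hcm.stronglyMeasurable)
        (fun _ x => (Complex.norm_exp_ofReal_mul_I _).le) (fun _ => tendsto_const_nhds)
      rw [← charFun_apply] at this
      refine this.congr fun ν => ?_
      rw [charFun_apply, integral_map (hZm ν).aemeasurable hcm.aestronglyMeasurable]
    -- Adding covariance matrices multiplies characteristic functions.
    have hlim : charFun (multivariateGaussian 0 (multinomialCov p + S)) t =
        charFun (multivariateGaussian 0 S) t * Complex.exp (-(V : ℂ) / 2) := by
      rw [charFun_multivariateGaussian ((posSemidef_multinomialCov hp).add hS.posSemidef),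
        charFun_multivariateGaussian hS.posSemidef, ← Complex.exp_add, Matrix.add_mulVec,
        dotProduct_add]
      congr 1
      push_cast
      ring
    rw [hlim]
    have hZV := hZ.mul_const (Complex.exp (-(V : ℂ) / 2))
    set U := ∑ c, |centredCoeff p t c|
    have hU : ∀ c, |centredCoeff p t c| ≤ U := fun c =>
      Finset.single_le_sum (f := fun c => |centredCoeff p t c|) (fun _ _ => abs_nonneg _)
        (Finset.mem_univ c)
    have hbound := (hs.const_mul (2 * U ^ 3)).add
      ((tendsto_integral_sum_abs_fullPerturbation hmodel j hS hs hn0 hd).const_mul (5 * U ^ 2))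
    rw [mul_zero, mul_zero, add_zero] at hbound
    have hUs : ∀ᶠ ν in atTop, (Real.sqrt (n ν j))⁻¹ * U ≤ 1 / 3 := by
      have := hs.mul_const U
      rw [zero_mul] at this
      exact this.eventually_le_const (by norm_num)
    have hdiff := squeeze_zero_norm' (by
      filter_upwards [hn0, hUs] with ν h0 h1
      exact (hmodel ν).norm_charFun_sub_le j h0 t hU h1) hbound
    have := hdiff.add hZV
    rw [zero_add] at this
    refine this.congr fun ν => ?_
    ring

end BatchLimit

/-! ### The main theorem. -/

theorem mainTheorem1 {d K : ℕ} (p : Fin (d + 1) → ℝ)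
    {Ω : ℕ → Type*} [∀ ν, MeasurableSpace (Ω ν)]
    (P : ∀ ν, Measure (Ω ν)) [∀ ν, IsProbabilityMeasure (P ν)]
    (n : ℕ → Fin K → ℕ)
    (ε : ∀ ν, Fin K → Ω ν → EuclideanSpace ℝ (Fin d))
    (X : ∀ ν, Fin K → Ω ν → Fin (d + 1) → ℕ)
    (hmodel : ∀ ν, IsBatchedMultinomialModel (P ν) p (n ν) (ε ν) (X ν)) :
    -- (a) moments of the batch counts
    (∀ ν j,
      (∀ c, MemLp (fun ω => (X ν j ω c : ℝ)) 2 (P ν) ∧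
        ∫ ω, (X ν j ω c : ℝ) ∂(P ν) = n ν j * p c) ∧
      (∀ c c', c ≠ c' →
        pairCov (fun ω => (X ν j ω c : ℝ)) (fun ω => (X ν j ω c' : ℝ)) (P ν) =
          (n ν j : ℝ) • multinomialBlock p c c' +
          ((n ν j : ℝ) * ((n ν j : ℝ) - 1)) •
            pairCov (fun ω => fullPerturbation (ε ν j ω) c)
              (fun ω => fullPerturbation (ε ν j ω) c') (P ν))) ∧
    -- (b) moments of the cumulative counts
    (∀ ν j,
      (∀ c, MemLp (fun ω => (cumCount (X ν) j ω c : ℝ)) 2 (P ν) ∧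
        ∫ ω, (cumCount (X ν) j ω c : ℝ) ∂(P ν) = cumTrials (n ν) j * p c) ∧
      (∀ c c', c ≠ c' →
        pairCov (fun ω => (cumCount (X ν) j ω c : ℝ))
            (fun ω => (cumCount (X ν) j ω c' : ℝ)) (P ν) =
          (cumTrials (n ν) j : ℝ) • multinomialBlock p c c' +
          ∑ i ∈ Finset.Iic j, ((n ν i : ℝ) * ((n ν i : ℝ) - 1)) •
            pairCov (fun ω => fullPerturbation (ε ν i ω) c)
              (fun ω => fullPerturbation (ε ν i ω) c') (P ν))) ∧
    -- (c) asymptotic normality of the observed proportions of a batch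
    (∀ (j : Fin K) (S : Matrix (Fin d) (Fin d) ℝ), S.PosDef →
      Tendsto (fun ν => n ν j) atTop atTop →
      DensityTendstoUniformly P (fun ν ω => Real.sqrt (n ν j) • ε ν j ω) (gaussianDensity S) →
      TendstoInDistribution
        (fun ν ω => Real.sqrt (n ν j) • (proportions (n ν j) (X ν j ω) - firstCells p)) atTop
        (id : EuclideanSpace ℝ (Fin d) → EuclideanSpace ℝ (Fin d)) P
        (multivariateGaussian 0 (multinomialCov p + S))) :=
  ⟨fun ν j => ⟨fun c => ⟨(hmodel ν).memLp_count j (fun k => (k c : ℝ)) 2,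
      (hmodel ν).integral_count_apply j c⟩, fun _ _ hc => (hmodel ν).pairCov_count j hc⟩,
    fun ν j => ⟨fun c => ⟨(hmodel ν).memLp_cumCount j c, (hmodel ν).integral_cumCount j c⟩,
      fun _ _ hc => (hmodel ν).pairCov_cumCount j hc⟩,
    fun j _ hS hn hd => tendstoInDistribution_proportions hmodel j hS hn hd⟩
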